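/- Let $n\ge 1$ and $A\in M_n(\mathbb C)$, and let $\|A\|_S=\max\{\|A\circ C\| : C\in M_n(\mathbb C),\ \|C\|=1\}$ be its Schur norm, where $\circ$ is the entrywise product and $\|\cdot\|$ is the operator norm on the Hilbert space $\mathbb C^n$. Consider the semidefinite programs in the variables $c\in\mathbb R$, $Y=Y^*,Z=Z^*\in M_n(\mathbb C)$ and $X\in M_n(\mathbb C)$, $v,w\in\mathbb R^n$: Primal problem: minimize $c$ subject to $\begin{bmatrix}Y&A\\A^*&Z\end{bmatrix}\succeq 0$ and $y_{jj}=z_{jj}=c$ for all $1\le j\le n$. Dual problem: maximize $\operatorname{Re}\operatorname{Tr}(AX^*)$ subject to $\begin{bmatrix}\operatorname{diag}(v)&X\\X^*&\operatorname{diag}(w)\end{bmatrix}\succeq 0$ and $\sum_{j}v_j+\sum_j w_j\le 2$. Then $\|A\|_S$ is the optimal value of each of the two problems, attained in both. Moreover, the two problems are Lagrange dual to each other: up to a rescaling and sign change of the multipliers, each problem is the Lagrange dual of the other. Precisely: (i) For Hermitian $Y,Z\in M_n(\mathbb C)$ and $c\ge 0$ (a condition that every feasible point of the primal problem satisfies),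 and for multipliers $W\succeq 0$ in $M_{2n}(\mathbb C)$ and $p,q\in\mathbb R^n$, let $$g(W,p,q)=\inf_{c\ge0,\;Y=Y^*,\;Z=Z^*}\Big(c-\operatorname{Re}\operatorname{Tr}\Big(W\begin{bmatrix}Y&A\\A^*&Z\end{bmatrix}\Big)+\sum_jp_j(y_{jj}-c)+\sum_jq_j(z_{jj}-c)\Big).$$ The map $(X,v,w)\mapsto\Big(\tfrac12\begin{bmatrix}\operatorname{diag}(v)&-X\\-X^*&\operatorname{diag}(w)\end{bmatrix},\tfrac12v,\tfrac12w\Big)$ is a bijection from the feasible set of the dual problem onto $\{(W,p,q):W\succeq0,\ g(W,p,q)>-\infty\}$, and at the image of $(X,v,w)$ the value of $g$ is $\operatorname{Re}\operatorname{Tr}(AX^*)$. (ii) For multipliers $N\succeq0$ in $M_{2n}(\mathbb C)$ and $\kappa\ge0$, let $$h(N,\kappa)=\sup_{X,v,w}\Big(\operatorname{Re}\operatorname{Tr}(AX^*)+\operatorname{Re}\operatorname{Tr}\Big(N\begin{bmatrix}\operatorname{diag}(v)&X\\X^*&\operatorname{diag}(w)\end{bmatrix}\Big)+\kappa\Big(2-\sum_jv_j-\sum_jw_j\Big)\Big),$$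 the supremum being over all $X\in M_n(\mathbb C)$ and $v,w\in\mathbb R^n$. The map $(c,Y,Z)\mapsto\Big(\tfrac12\begin{bmatrix}Y&-A\\-A^*&Z\end{bmatrix},\tfrac12c\Big)$ is a bijection from the feasible set of the primal problem onto $\{(N,\kappa):N\succeq0,\ \kappa\ge0,\ h(N,\kappa)<\infty\}$, and at the image of $(c,Y,Z)$ the value of $h$ is $c$. -/

import Mathlib

open scoped Matrix ComplexOrder

section SchurNorm

open scoped Matrix.Norms.L2Operator

/-- The set of all `‖A ∘ C‖` with `‖C‖ = 1`, where `∘` is the entrywise product and `‖·‖` is the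
operator norm on the Hilbert space `ℂⁿ`. -/
def schurValues {n : ℕ} (A : Matrix (Fin n) (Fin n) ℂ) : Set ℝ :=
  (fun C : Matrix (Fin n) (Fin n) ℂ => ‖A.hadamard C‖) '' {C | ‖C‖ = 1}

/-- The Schur norm `‖A‖_S = max {‖A ∘ C‖ : ‖C‖ = 1}`; see `isGreatest_schurNorm` for the fact that
the supremum is a maximum. -/
noncomputable def schurNorm {n : ℕ} (A : Matrix (Fin n) (Fin n) ℂ) : ℝ :=
  sSup (schurValues A)

theorem isGreatest_schurNorm {n : ℕ} (hn : 0 < n) (A : Matrix (Fin n) (Fin n) ℂ) :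
    IsGreatest (schurValues A) (schurNorm A) := by
  have : Nonempty (Fin n) := ⟨⟨0, hn⟩⟩
  have : ProperSpace (Matrix (Fin n) (Fin n) ℂ) := FiniteDimensional.proper ℂ _
  have hset : {C : Matrix (Fin n) (Fin n) ℂ | ‖C‖ = 1} = Metric.sphere 0 1 := by
    ext C; simp
  have hcont : Continuous (fun C : Matrix (Fin n) (Fin n) ℂ => ‖A.hadamard C‖) := by
    refine continuous_norm.comp ?_
    refine continuous_matrix fun i j => ?_
    exact continuous_const.mul (continuous_id.matrix_elem i j)
  have hcomp : IsCompact (schurValues A) := by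
    unfold schurValues
    rw [hset]
    exact (isCompact_sphere _ _).image hcont
  have hne : (schurValues A).Nonempty := by
    refine Set.Nonempty.image _ ⟨1, ?_⟩
    exact norm_one
  exact hcomp.isGreatest_sSup hne

end SchurNorm

/-- The variables `(c, Y, Z)` of the primal problem. -/
structure PrimalPoint (n : ℕ) where
  c : ℝ
  Y : Matrix (Fin n) (Fin n) ℂ
  Z : Matrix (Fin n) (Fin n) ℂ

/-- The variables `(X, v, w)` of the dual problem. -/
structure DualPoint (n : ℕ) where
  X : Matrix (Fin n) (Fin n) ℂ
  v : Fin n → ℝ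
  w : Fin n → ℝ

/-- The block matrix `[[Y, A], [A*, Z]]`. -/
def PrimalPoint.block {n : ℕ} (A : Matrix (Fin n) (Fin n) ℂ) (x : PrimalPoint n) :
    Matrix (Fin n ⊕ Fin n) (Fin n ⊕ Fin n) ℂ :=
  Matrix.fromBlocks x.Y A Aᴴ x.Z

/-- The block matrix `[[diag v, X], [X*, diag w]]`. -/
def DualPoint.block {n : ℕ} (y : DualPoint n) : Matrix (Fin n ⊕ Fin n) (Fin n ⊕ Fin n) ℂ :=
  Matrix.fromBlocks (Matrix.diagonal fun j => (y.v j : ℂ)) y.X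
    y.Xᴴ (Matrix.diagonal fun j => (y.w j : ℂ))

/-- Feasible set of the primal problem (whose objective, to be minimized, is `c`). -/
def primalFeasible {n : ℕ} (A : Matrix (Fin n) (Fin n) ℂ) : Set (PrimalPoint n) :=
  {x | x.Y.IsHermitian ∧ x.Z.IsHermitian ∧ (x.block A).PosSemidef ∧
    ∀ j, x.Y j j = (x.c : ℂ) ∧ x.Z j j = (x.c : ℂ)}

/-- Feasible set of the dual problem. -/
def dualFeasible (n : ℕ) : Set (DualPoint n) :=
  {y | y.block.PosSemidef ∧ ∑ j, y.v j + ∑ j, y.w j ≤ 2}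

/-- Objective `Re Tr(A X*)` of the dual problem, to be maximized. -/
noncomputable def dualObjective {n : ℕ} (A : Matrix (Fin n) (Fin n) ℂ) (y : DualPoint n) : ℝ :=
  (A * y.Xᴴ).trace.re

/-! Lagrange duality between the two problems. -/

/-- Lagrangian of the maximization problem, with multipliers `N ⪰ 0` for the semidefinite
constraint and `κ ≥ 0` for the inequality `∑ v + ∑ w ≤ 2`. -/
noncomputable def dualLagrangian {n : ℕ} (A : Matrix (Fin n) (Fin n) ℂ) (y : DualPoint n)
    (m : Matrix (Fin n ⊕ Fin n) (Fin n ⊕ Fin n) ℂ × ℝ) : ℝ :=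
  dualObjective A y + (m.1 * y.block).trace.re + m.2 * (2 - (∑ j, y.v j + ∑ j, y.w j))

/-- Lagrange dual function of the maximization problem: the supremum of the Lagrangian over all
unconstrained `(X, v, w)`. -/
noncomputable def dualLagrangeFun {n : ℕ} (A : Matrix (Fin n) (Fin n) ℂ)
    (m : Matrix (Fin n ⊕ Fin n) (Fin n ⊕ Fin n) ℂ × ℝ) : EReal :=
  ⨆ y : DualPoint n, (dualLagrangian A y m : EReal)

/-- Domain of the Lagrangian of the minimization problem: Hermitian `Y`, `Z` and `c ≥ 0`. The sign
condition holds at every feasible point, since the diagonal of a positive semidefinite matrix is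
nonnegative; keeping it in the domain is what gives `≤ 2` and not `= 2` in the dual. -/
def primalDomain (n : ℕ) : Set (PrimalPoint n) :=
  {x | x.Y.IsHermitian ∧ x.Z.IsHermitian ∧ 0 ≤ x.c}

/-- Lagrangian of the minimization problem, with multipliers `W ⪰ 0` for the semidefinite
constraint and `p, q ∈ ℝⁿ` for the equations `y_jj = c` and `z_jj = c`. -/
noncomputable def primalLagrangian {n : ℕ} (A : Matrix (Fin n) (Fin n) ℂ) (x : PrimalPoint n)
    (m : Matrix (Fin n ⊕ Fin n) (Fin n ⊕ Fin n) ℂ × (Fin n → ℝ) × (Fin n → ℝ)) : ℝ :=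
  x.c - (m.1 * x.block A).trace.re + ∑ j, m.2.1 j * ((x.Y j j).re - x.c)
    + ∑ j, m.2.2 j * ((x.Z j j).re - x.c)

/-- Lagrange dual function of the minimization problem: the infimum of the Lagrangian. -/
noncomputable def primalLagrangeFun {n : ℕ} (A : Matrix (Fin n) (Fin n) ℂ)
    (m : Matrix (Fin n ⊕ Fin n) (Fin n ⊕ Fin n) ℂ × (Fin n → ℝ) × (Fin n → ℝ)) : EReal :=
  ⨅ x ∈ primalDomain n, (primalLagrangian A x m : EReal)

/-- The multipliers `½ [[diag v, -X], [-X*, diag w]]`, `½ v`, `½ w` of the minimization problem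
that correspond to the point `(X, v, w)`. -/
noncomputable def DualPoint.toMultiplier {n : ℕ} (y : DualPoint n) :
    Matrix (Fin n ⊕ Fin n) (Fin n ⊕ Fin n) ℂ × (Fin n → ℝ) × (Fin n → ℝ) :=
  ((1 / 2 : ℂ) • Matrix.fromBlocks (Matrix.diagonal fun j => (y.v j : ℂ)) (-y.X)
      (-y.Xᴴ) (Matrix.diagonal fun j => (y.w j : ℂ)),
    fun j => y.v j / 2, fun j => y.w j / 2)

/-- The multipliers `½ [[Y, -A], [-A*, Z]]`, `½ c` of the maximization problem that correspond to
the point `(c, Y, Z)`. -/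
noncomputable def PrimalPoint.toMultiplier {n : ℕ} (A : Matrix (Fin n) (Fin n) ℂ)
    (x : PrimalPoint n) : Matrix (Fin n ⊕ Fin n) (Fin n ⊕ Fin n) ℂ × ℝ :=
  ((1 / 2 : ℂ) • Matrix.fromBlocks x.Y (-A) (-Aᴴ) x.Z, x.c / 2)

/-- The maximization problem is the Lagrange dual of the minimization problem: the admissible
multipliers with dual function `≠ -∞` are exactly the feasible points `(X, v, w)`, in the
parametrization `toMultiplier`, and the dual function there is the objective `Re Tr(A X*)`. -/
def DualIsLagrangeDualOfPrimal {n : ℕ} (A : Matrix (Fin n) (Fin n) ℂ) : Prop :=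
  Set.BijOn DualPoint.toMultiplier (dualFeasible n)
      {m | m.1.PosSemidef ∧ ⊥ < primalLagrangeFun A m} ∧
    ∀ y ∈ dualFeasible n, primalLagrangeFun A y.toMultiplier = (dualObjective A y : EReal)

/-- The minimization problem is the Lagrange dual of the maximization problem: the admissible
multipliers with dual function `≠ +∞` are exactly the feasible points `(c, Y, Z)`, in the
parametrization `toMultiplier`, and the dual function there is the objective `c`. -/
def PrimalIsLagrangeDualOfDual {n : ℕ} (A : Matrix (Fin n) (Fin n) ℂ) : Prop :=
  Set.BijOn (PrimalPoint.toMultiplier A) (primalFeasible A)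
      {m | m.1.PosSemidef ∧ 0 ≤ m.2 ∧ dualLagrangeFun A m < ⊤} ∧
    ∀ x ∈ primalFeasible A, dualLagrangeFun A (x.toMultiplier A) = (x.c : EReal)

/-! The dual value is a Schur norm in disguise. If `X = diag(ξ) C̄ diag(η)*` with `‖C‖ ≤ 1`, then
`Tr(A X*)` is the sesquilinear form of `A ∘ C` at `ξ, η`. A maximizing `C` with optimal `ξ, η` gives
a dual point of value `‖A‖_S` (`exists_dualFeasible_objective_eq`). Conversely, a positive
semidefinite block factors this way after a perturbation, and AM-GM bounds its objective
(`dualObjective_le_schurNorm_mul`).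

A primal point with `c = ‖A‖_S` is a positive semidefinite completion of a partial matrix: constant
diagonal, corner `A`. The completable data form a closed convex cone, and a functional separating
the data from it would be a point `(X, v, w)` violating the bound above
(`exists_primalFeasible_schurNorm`). With both values attained, `weak_duality` gives optimality.

For Lagrange duality, each Lagrangian is affine in its variables. A finite dual function forces the
slopes in free directions to vanish, which leaves exactly the constraints of the other problem. -/

theorem dualObjective_eq_sum {n : ℕ} (A : Matrix (Fin n) (Fin n) ℂ) (y : DualPoint n) :
    dualObjective A y = (∑ i, ∑ j, A i j * star (y.X i j)).re := by
  simp [dualObjective, Matrix.trace, Matrix.mul_apply]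

/-! ### The dual objective and the operator norm of `A ∘ C`. -/

section OperatorNorm

open scoped Matrix.Norms.L2Operator MatrixOrder

/-- The Schur complement of the upper left identity block is `1 - C* C`, and `‖C* C‖ = ‖C‖²`. -/
theorem Matrix.norm_le_one_iff_posSemidef_fromBlocks {n : ℕ} (C : Matrix (Fin n) (Fin n) ℂ) :
    ‖C‖ ≤ 1 ↔ (Matrix.fromBlocks 1 C Cᴴ 1).PosSemidef := by
  have : Invertible (1 : Matrix (Fin n) (Fin n) ℂ) := invertibleOne
  have h := Matrix.PosDef.fromBlocks₁₁ C (1 : Matrix (Fin n) (Fin n) ℂ) Matrix.PosDef.one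
  rw [h, inv_one, mul_one, ← Matrix.le_iff,
    ← CStarAlgebra.norm_le_one_iff_of_nonneg (Cᴴ * C) (star_mul_self_nonneg C),
    Matrix.l2_opNorm_conjTranspose_mul_self, ← sq, sq_le_one_iff₀ (norm_nonneg _)]

/-- Transposing the block matrix of `C` preserves positivity and turns the corner into the entrywise
conjugate. -/
theorem Matrix.norm_map_star_le_one {n : ℕ} {C : Matrix (Fin n) (Fin n) ℂ} (h : ‖C‖ ≤ 1) :
    ‖C.map star‖ ≤ 1 := by
  rw [Matrix.norm_le_one_iff_posSemidef_fromBlocks] at h ⊢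
  have := h.transpose
  rw [Matrix.fromBlocks_transpose] at this
  have h2 : (C.map star)ᴴ = Cᵀ := by
    ext i j
    simp
  rw [h2]
  rwa [Matrix.transpose_one] at this

/-- Every value `‖A ∘ C‖` is at most `‖A‖_S ‖C‖`. -/
theorem norm_hadamard_le_schurNorm {n : ℕ} (hn : 0 < n) (A C : Matrix (Fin n) (Fin n) ℂ)
    (hC : ‖C‖ ≤ 1) : ‖A.hadamard C‖ ≤ schurNorm A := by
  have hle : ∀ D : Matrix (Fin n) (Fin n) ℂ, ‖D‖ = 1 → ‖A.hadamard D‖ ≤ schurNorm A :=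
    fun D hD => (isGreatest_schurNorm hn A).2 ⟨D, hD, rfl⟩
  have hs : 0 ≤ schurNorm A := by
    obtain ⟨D, -, hD⟩ := (isGreatest_schurNorm hn A).1
    rw [← hD]
    exact norm_nonneg _
  rcases eq_or_ne C 0 with rfl | h0
  · simpa using hs
  · have hpos : 0 < ‖C‖ := norm_pos_iff.2 h0
    have h1 := hle ((‖C‖⁻¹ : ℂ) • C) (by
      rw [norm_smul]
      simp [hpos.ne'])
    rw [Matrix.hadamard_smul, norm_smul] at h1
    simp only [norm_inv, Complex.norm_real, norm_norm] at h1
    rw [inv_mul_le_iff₀ hpos] at h1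
    nlinarith

theorem Matrix.re_dotProduct_mulVec_le {n : ℕ} (B : Matrix (Fin n) (Fin n) ℂ)
    (x y : EuclideanSpace ℂ (Fin n)) :
    (∑ i, ∑ j, star (x i) * B i j * y j).re ≤ ‖B‖ * ‖x‖ * ‖y‖ := by
  have h : ∑ i, ∑ j, star (x i) * B i j * y j
      = inner ℂ x ((EuclideanSpace.equiv (Fin n) ℂ).symm (B *ᵥ y.ofLp)) := by
    rw [PiLp.inner_apply]
    refine Finset.sum_congr rfl fun i _ => ?_
    simp [Matrix.mulVec, dotProduct, Finset.sum_mul]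
    exact Finset.sum_congr rfl fun j _ => by ring
  rw [h]
  calc _ ≤ ‖inner ℂ x ((EuclideanSpace.equiv (Fin n) ℂ).symm (B *ᵥ y.ofLp))‖ :=
        Complex.re_le_norm _
    _ ≤ _ := norm_inner_le_norm _ _
    _ ≤ ‖x‖ * (‖B‖ * ‖y‖) := by
        gcongr
        exact Matrix.l2_opNorm_mulVec B y
    _ = _ := by ring

/-- The operator norm is attained by the sesquilinear form on the unit balls. -/
theorem Matrix.exists_dotProduct_mulVec_eq_norm {n : ℕ} (B : Matrix (Fin n) (Fin n) ℂ) :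
    ∃ x y : EuclideanSpace ℂ (Fin n), ‖x‖ ≤ 1 ∧ ‖y‖ ≤ 1 ∧
      ∑ i, ∑ j, star (x i) * B i j * y j = (‖B‖ : ℂ) := by
  set T := (Matrix.toEuclideanLin ≪≫ₗ LinearMap.toContinuousLinearMap) B with hT
  have hTa : ∀ y i, T y i = ∑ j, B i j * y j := by
    intro y i
    simp [hT, Matrix.mulVec, dotProduct]
  obtain ⟨y, hy, hmax⟩ := (isCompact_closedBall (0 : EuclideanSpace ℂ (Fin n)) 1).exists_isMaxOn
    ⟨0, by simp⟩ (f := fun y => ‖T y‖) (by fun_prop)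
  have hy1 : ‖y‖ ≤ 1 := by simpa using hy
  have hnorm : ‖B‖ = ‖T y‖ := by
    rw [Matrix.l2_opNorm_def, ← hT]
    refine le_antisymm ?_ ((T.le_opNorm y).trans (mul_le_of_le_one_right (norm_nonneg _) hy1))
    refine T.opNorm_le_of_unit_norm (norm_nonneg _) fun z hz => ?_
    exact hmax (by simp [hz])
  -- If `T y = 0`, the inverse is `0` and so is this vector; hence only `‖x‖ ≤ 1` is claimed.
  refine ⟨((‖T y‖⁻¹ : ℝ) : ℂ) • T y, y, ?_, hy1, ?_⟩
  · rw [norm_smul]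
    simp only [Complex.norm_real, norm_inv, norm_norm]
    exact inv_mul_le_one
  · have h : ∑ i, ∑ j, star ((((‖T y‖⁻¹ : ℝ) : ℂ) • T y) i) * B i j * y j
        = inner ℂ (((‖T y‖⁻¹ : ℝ) : ℂ) • T y) (T y) := by
      rw [PiLp.inner_apply]
      refine Finset.sum_congr rfl fun i _ => ?_
      rw [RCLike.inner_apply, hTa y i, Finset.sum_mul]
      refine Finset.sum_congr rfl fun j _ => ?_
      rw [starRingEnd_apply]
      ring
    rw [h, inner_smul_left, inner_self_eq_norm_sq_to_K, hnorm, Complex.conj_ofReal]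
    rcases eq_or_ne ‖T y‖ 0 with h0 | h0
    · simp [h0]
    · push_cast
      have : (‖T y‖ : ℂ) ≠ 0 := by exact_mod_cast h0
      simp only [Complex.coe_algebraMap]
      field_simp

theorem exists_dualFeasible_objective_eq {n : ℕ} (hn : 0 < n) (A : Matrix (Fin n) (Fin n) ℂ) :
    ∃ y ∈ dualFeasible n, dualObjective A y = schurNorm A := by
  obtain ⟨C, hC, hmax⟩ := (isGreatest_schurNorm hn A).1
  obtain ⟨ξ, η, hξ, hη, hval⟩ := Matrix.exists_dotProduct_mulVec_eq_norm (A.hadamard C)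
  have hP := (Matrix.norm_le_one_iff_posSemidef_fromBlocks _).1
    (Matrix.norm_map_star_le_one (le_of_eq hC))
  refine ⟨⟨Matrix.diagonal ξ * C.map star * (Matrix.diagonal η)ᴴ,
    fun j => ‖ξ j‖ ^ 2, fun j => ‖η j‖ ^ 2⟩, ⟨?_, ?_⟩, ?_⟩
  · have h := hP.mul_mul_conjTranspose_same
      (Matrix.fromBlocks (Matrix.diagonal ξ) 0 0 (Matrix.diagonal η))
    convert h using 1
    simp only [DualPoint.block, Matrix.fromBlocks_conjTranspose, Matrix.fromBlocks_multiply,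
      Matrix.conjTranspose_zero, Matrix.mul_zero, Matrix.zero_mul, add_zero, zero_add,
      Matrix.mul_one, Matrix.conjTranspose_mul, Matrix.conjTranspose_conjTranspose,
      Matrix.mul_assoc]
    simp [Matrix.diagonal_conjTranspose, Matrix.diagonal_mul_diagonal, Complex.mul_conj,
      Complex.normSq_eq_norm_sq]
  · rw [← EuclideanSpace.norm_sq_eq, ← EuclideanSpace.norm_sq_eq]
    nlinarith [norm_nonneg ξ, norm_nonneg η]
  · have hmax' : ‖A.hadamard C‖ = schurNorm A := hmax
    rw [dualObjective_eq_sum, ← hmax', ← Complex.ofReal_re (norm _), ← hval]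
    congr 1
    refine Finset.sum_congr rfl fun i _ => Finset.sum_congr rfl fun j _ => ?_
    simp [Matrix.diagonal_conjTranspose, Matrix.hadamard_apply]
    ring

/-- Positivity of `v, w` allows division: congruence by the inverse square roots makes both diagonal
blocks `1`, so the rescaled corner `C` is a contraction. The objective is then the form of `A ∘ C̄`
at `√v, √w`. -/
theorem dualObjective_le_of_pos {n : ℕ} (hn : 0 < n) (A : Matrix (Fin n) (Fin n) ℂ)
    (y : DualPoint n) (hy : y.block.PosSemidef) (hv : ∀ j, 0 < y.v j) (hw : ∀ j, 0 < y.w j) :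
    dualObjective A y ≤ schurNorm A * ((∑ j, y.v j + ∑ j, y.w j) / 2) := by
  set a : Fin n → ℂ := fun j => ((√(y.v j) : ℝ) : ℂ) with ha
  set b : Fin n → ℂ := fun j => ((√(y.w j) : ℝ) : ℂ) with hb
  have ha0 : ∀ j, a j ≠ 0 := fun j => by
    simpa [ha] using (Real.sqrt_pos.2 (hv j)).ne'
  have hb0 : ∀ j, b j ≠ 0 := fun j => by
    simpa [hb] using (Real.sqrt_pos.2 (hw j)).ne'
  have haa : ∀ j, (y.v j : ℂ) = a j * a j := fun j => by
    simp only [ha]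
    rw [← Complex.ofReal_mul, Real.mul_self_sqrt (hv j).le]
  have hbb : ∀ j, (y.w j : ℂ) = b j * b j := fun j => by
    simp only [hb]
    rw [← Complex.ofReal_mul, Real.mul_self_sqrt (hw j).le]
  set C : Matrix (Fin n) (Fin n) ℂ := Matrix.of fun i j => (a i)⁻¹ * y.X i j * (b j)⁻¹ with hC
  have hsa : ∀ j, (starRingEnd ℂ) (a j) = a j := fun j => Complex.conj_ofReal _
  have hsb : ∀ j, (starRingEnd ℂ) (b j) = b j := fun j => Complex.conj_ofReal _
  have hC1 : ‖C‖ ≤ 1 := by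
    rw [Matrix.norm_le_one_iff_posSemidef_fromBlocks]
    have h := hy.mul_mul_conjTranspose_same
      (Matrix.diagonal (Sum.elim (fun j => (a j)⁻¹) (fun j => (b j)⁻¹)))
    convert h using 1
    ext i j
    rw [Matrix.diagonal_conjTranspose, Matrix.mul_diagonal, Matrix.diagonal_mul]
    rcases i with i | i <;> rcases j with j | j
    · rcases eq_or_ne i j with rfl | hij
      · simp [DualPoint.block, haa, hsa, ha0]
      · simp [DualPoint.block, hij]
    · simp [DualPoint.block, hC, hsb]
    · simp [DualPoint.block, hC, hsb, hsa]
      ring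
    · rcases eq_or_ne i j with rfl | hij
      · simp [DualPoint.block, hbb, hsb, hb0]
      · simp [DualPoint.block, hij]
  have hB := norm_hadamard_le_schurNorm hn A _ (Matrix.norm_map_star_le_one hC1)
  have hna : ‖WithLp.toLp 2 a‖ ^ 2 = ∑ j, y.v j := by
    rw [EuclideanSpace.norm_sq_eq]
    refine Finset.sum_congr rfl fun j _ => ?_
    simp [ha, Real.sq_sqrt (hv j).le]
  have hnb : ‖WithLp.toLp 2 b‖ ^ 2 = ∑ j, y.w j := by
    rw [EuclideanSpace.norm_sq_eq]
    refine Finset.sum_congr rfl fun j _ => ?_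
    simp [hb, Real.sq_sqrt (hw j).le]
  have h := Matrix.re_dotProduct_mulVec_le (A.hadamard (C.map star))
    (WithLp.toLp 2 a) (WithLp.toLp 2 b)
  have he : dualObjective A y = (∑ i, ∑ j, star ((WithLp.toLp 2 a : EuclideanSpace ℂ (Fin n)) i) *
      (A.hadamard (C.map star)) i j * (WithLp.toLp 2 b : EuclideanSpace ℂ (Fin n)) j).re := by
    rw [dualObjective_eq_sum]
    congr 1
    refine Finset.sum_congr rfl fun i _ => Finset.sum_congr rfl fun j _ => ?_
    simp only [Matrix.hadamard_apply, Matrix.map_apply, hC, Matrix.of_apply, ← starRingEnd_apply,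
      map_mul, map_inv₀, hsa, hsb]
    have h1 := ha0 i
    have h2 := hb0 j
    field_simp
  rw [← he] at h
  rw [← hna, ← hnb]
  have hB0 := norm_nonneg (A.hadamard (C.map star))
  -- AM-GM replaces the product of norms by the half-sum appearing in the budget constraint.
  have h2 : ‖WithLp.toLp 2 a‖ * ‖WithLp.toLp 2 b‖
      ≤ (‖WithLp.toLp 2 a‖ ^ 2 + ‖WithLp.toLp 2 b‖ ^ 2) / 2 := by
    nlinarith [sq_nonneg (‖WithLp.toLp 2 a‖ - ‖WithLp.toLp 2 b‖)]
  calc _ ≤ _ := h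
    _ = ‖A.hadamard (C.map star)‖ * (‖WithLp.toLp 2 a‖ * ‖WithLp.toLp 2 b‖) := by ring
    _ ≤ _ := by
        have := hB0.trans hB
        gcongr

end OperatorNorm

/-- Adding `ε` to the diagonal reduces to positive `v, w`; then `ε → 0`. -/
theorem dualObjective_le_schurNorm_mul {n : ℕ} (hn : 0 < n) (A : Matrix (Fin n) (Fin n) ℂ)
    (y : DualPoint n) (hy : y.block.PosSemidef) :
    dualObjective A y ≤ schurNorm A * ((∑ j, y.v j + ∑ j, y.w j) / 2) := by
  have hv : ∀ j, 0 ≤ y.v j := fun j => by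
    simpa [DualPoint.block] using hy.diag_nonneg (i := Sum.inl j)
  have hw : ∀ j, 0 ≤ y.w j := fun j => by
    simpa [DualPoint.block] using hy.diag_nonneg (i := Sum.inr j)
  have key : ∀ ε : ℝ, 0 < ε → dualObjective A y
      ≤ schurNorm A * ((∑ j, (y.v j + ε) + ∑ j, (y.w j + ε)) / 2) := by
    intro ε hε
    refine dualObjective_le_of_pos hn A ⟨y.X, fun j => y.v j + ε, fun j => y.w j + ε⟩ ?_
      (fun j => by have := hv j; positivity) (fun j => by have := hw j; positivity)
    have h1 : ((ε : ℂ) • (1 : Matrix (Fin n ⊕ Fin n) (Fin n ⊕ Fin n) ℂ)).PosSemidef :=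
      Matrix.PosSemidef.one.smul (by exact_mod_cast hε.le)
    convert hy.add h1 using 1
    ext i j
    rcases i with i | i <;> rcases j with j | j <;>
      simp [DualPoint.block, Matrix.diagonal_apply, Matrix.one_apply] <;> split_ifs <;> simp
  have hcont : Continuous fun ε : ℝ =>
      schurNorm A * ((∑ j, (y.v j + ε) + ∑ j, (y.w j + ε)) / 2) := by fun_prop
  have hlim := (hcont.tendsto 0).mono_left (nhdsWithin_le_nhds (s := Set.Ioi 0))
  have := ge_of_tendsto hlim (Filter.eventually_of_mem self_mem_nhdsWithin fun ε hε => key ε hε)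
  simpa using this

/-! ### Trace pairings and block matrices. -/

theorem Matrix.PosSemidef.re_trace_mul_nonneg {m : Type*} [Fintype m] [DecidableEq m]
    {M N : Matrix m m ℂ} (hM : M.PosSemidef) (hN : N.PosSemidef) : 0 ≤ (M * N).trace.re := by
  obtain ⟨B, rfl⟩ : ∃ B, M = Bᴴ * B := by
    open scoped MatrixOrder Matrix.Norms.L2Operator in
    exact CStarAlgebra.nonneg_iff_eq_star_mul_self.1 hM.nonneg
  rw [Matrix.mul_assoc, Matrix.trace_mul_comm]
  exact (Complex.nonneg_iff.1 (hN.mul_mul_conjTranspose_same B).trace_nonneg).1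

/-- Changing the sign of the off-diagonal blocks preserves positive semidefiniteness. -/
theorem Matrix.posSemidef_fromBlocks_neg_iff {n : ℕ} (P X Y Q : Matrix (Fin n) (Fin n) ℂ) :
    (Matrix.fromBlocks P (-X) (-Y) Q).PosSemidef ↔ (Matrix.fromBlocks P X Y Q).PosSemidef := by
  have key : ∀ X Y : Matrix (Fin n) (Fin n) ℂ, (Matrix.fromBlocks P X Y Q).PosSemidef →
      (Matrix.fromBlocks P (-X) (-Y) Q).PosSemidef := by
    intro X Y h
    -- Congruence by `diag(1, -1)`.
    have := h.mul_mul_conjTranspose_same (Matrix.fromBlocks (1 : Matrix (Fin n) (Fin n) ℂ) 0 0 (-1 : Matrix (Fin n) (Fin n) ℂ))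
    simpa [Matrix.fromBlocks_conjTranspose, Matrix.fromBlocks_multiply] using this
  refine ⟨fun h => ?_, key X Y⟩
  simpa using key _ _ h

theorem Matrix.posSemidef_half_smul_iff {m : Type*} [Fintype m] (M : Matrix m m ℂ) :
    ((1 / 2 : ℂ) • M).PosSemidef ↔ M.PosSemidef := by
  constructor
  · intro h
    have := h.smul (a := (2 : ℂ)) (by norm_num)
    simpa [smul_smul] using this
  · intro h
    exact h.smul (by norm_num [Complex.le_def])

theorem re_trace_mul_conjTranspose_comm {n : ℕ} (A X : Matrix (Fin n) (Fin n) ℂ) :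
    (X * Aᴴ).trace.re = (A * Xᴴ).trace.re := by
  have : X * Aᴴ = (A * Xᴴ)ᴴ := by simp [Matrix.conjTranspose_mul]
  rw [this, Matrix.trace_conjTranspose]
  simp

theorem Matrix.trace_fromBlocks_mul_fromBlocks {n : ℕ}
    (P Q R S P' Q' R' S' : Matrix (Fin n) (Fin n) ℂ) :
    (Matrix.fromBlocks P Q R S * Matrix.fromBlocks P' Q' R' S').trace
      = (P * P').trace + (Q * R').trace + (R * Q').trace + (S * S').trace := by
  simp [Matrix.fromBlocks_multiply, Matrix.trace, Finset.sum_add_distrib, add_assoc]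

theorem re_trace_diagonal_mul {n : ℕ} (p : Fin n → ℝ) (Y : Matrix (Fin n) (Fin n) ℂ) :
    (Matrix.diagonal (fun j => (p j : ℂ)) * Y).trace.re = ∑ j, p j * (Y j j).re := by
  simp [Matrix.trace, Matrix.diagonal_mul]

theorem re_trace_mul_diagonal {n : ℕ} (p : Fin n → ℝ) (Y : Matrix (Fin n) (Fin n) ℂ) :
    (Y * Matrix.diagonal (fun j => (p j : ℂ))).trace.re = ∑ j, p j * (Y j j).re := by
  rw [Matrix.trace_mul_comm, re_trace_diagonal_mul]

theorem DualPoint.posSemidef_toMultiplier_iff {n : ℕ} (y : DualPoint n) :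
    y.toMultiplier.1.PosSemidef ↔ y.block.PosSemidef := by
  rw [DualPoint.toMultiplier, Matrix.posSemidef_half_smul_iff,
    Matrix.posSemidef_fromBlocks_neg_iff]
  rfl

theorem PrimalPoint.posSemidef_toMultiplier_iff {n : ℕ} (A : Matrix (Fin n) (Fin n) ℂ)
    (x : PrimalPoint n) : (x.toMultiplier A).1.PosSemidef ↔ (x.block A).PosSemidef := by
  rw [PrimalPoint.toMultiplier, Matrix.posSemidef_half_smul_iff,
    Matrix.posSemidef_fromBlocks_neg_iff]
  rfl

/-! ### Weak duality and the Lagrangian of the minimization problem. -/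

theorem primalFeasible.c_nonneg {n : ℕ} (hn : 0 < n) {A : Matrix (Fin n) (Fin n) ℂ}
    {x : PrimalPoint n} (hx : x ∈ primalFeasible A) : 0 ≤ x.c := by
  have h := hx.2.2.1.diag_nonneg (i := Sum.inl ⟨0, hn⟩)
  simpa [PrimalPoint.block, (hx.2.2.2 ⟨0, hn⟩).1] using h

/-- The terms in `Y` and `Z` cancel against the multipliers `v/2, w/2`, and each off-diagonal block
contributes half of the objective. -/
theorem primalLagrangian_toMultiplier {n : ℕ} (A : Matrix (Fin n) (Fin n) ℂ) (x : PrimalPoint n)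
    (y : DualPoint n) : primalLagrangian A x y.toMultiplier
      = dualObjective A y + x.c * (1 - (∑ j, y.v j + ∑ j, y.w j) / 2) := by
  have h1 := re_trace_diagonal_mul y.v x.Y
  have h2 := re_trace_diagonal_mul y.w x.Z
  have h3 := re_trace_mul_conjTranspose_comm A y.X
  have h4 : (y.Xᴴ * A).trace.re = (A * y.Xᴴ).trace.re := by rw [Matrix.trace_mul_comm]
  simp only [primalLagrangian, DualPoint.toMultiplier, PrimalPoint.block, Matrix.smul_mul,
    Matrix.trace_smul, Matrix.trace_fromBlocks_mul_fromBlocks, dualObjective, mul_sub,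
    Finset.sum_sub_distrib, ← Finset.sum_mul, ← Finset.sum_div, div_mul_eq_mul_div,
    Matrix.neg_mul, Matrix.trace_neg]
  simp only [smul_eq_mul, Complex.mul_re, Complex.add_re, Complex.neg_re]
  norm_num
  rw [h1, h2, h3, h4]
  ring

/-- On feasible points the equality terms vanish, so the Lagrangian is `c` minus a nonnegative
trace; by `primalLagrangian_toMultiplier` it is also the objective plus a nonnegative term. -/
theorem weak_duality {n : ℕ} (hn : 0 < n) {A : Matrix (Fin n) (Fin n) ℂ} {x : PrimalPoint n}
    {y : DualPoint n} (hx : x ∈ primalFeasible A) (hy : y ∈ dualFeasible n) :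
    dualObjective A y ≤ x.c := by
  have h1 := (y.posSemidef_toMultiplier_iff.2 hy.1).re_trace_mul_nonneg hx.2.2.1
  have h2 := primalLagrangian_toMultiplier A x y
  have h3 := mul_nonneg (primalFeasible.c_nonneg hn hx) (sub_nonneg.2
    (show (∑ j, y.v j + ∑ j, y.w j) / 2 ≤ 1 by linarith [hy.2]))
  have h4 : primalLagrangian A x y.toMultiplier
      = x.c - (y.toMultiplier.1 * x.block A).trace.re := by
    simp [primalLagrangian, hx.2.2.2]
  linarith

theorem eq_zero_of_forall_le_add_mul {r a b : ℝ} (h : ∀ t : ℝ, r ≤ a + t * b) : b = 0 := by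
  by_contra hb
  -- Here the affine function takes the value `r - 1`.
  have := h ((r - a - 1) / b)
  rw [div_mul_cancel₀ _ hb] at this
  linarith

theorem nonneg_of_forall_le_add_mul {r a b : ℝ} (h : ∀ t : ℝ, 0 ≤ t → r ≤ a + t * b) :
    0 ≤ b := by
  by_contra! hb
  have h0 := h 0 le_rfl
  have := h ((r - a - 1) / b) (div_nonneg_of_nonpos (by linarith) hb.le)
  rw [div_mul_cancel₀ _ hb.ne] at this
  linarith

theorem primalLagrangeFun_toMultiplier {n : ℕ} (A : Matrix (Fin n) (Fin n) ℂ) {y : DualPoint n}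
    (hy : y ∈ dualFeasible n) :
    primalLagrangeFun A y.toMultiplier = (dualObjective A y : EReal) := by
  refine le_antisymm ?_ (le_iInf₂ fun x hx => ?_)
  · refine (iInf₂_le (⟨0, 0, 0⟩ : PrimalPoint n) ⟨Matrix.isHermitian_zero,
      Matrix.isHermitian_zero, le_rfl⟩).trans (le_of_eq ?_)
    rw [primalLagrangian_toMultiplier]
    simp
  · rw [primalLagrangian_toMultiplier, EReal.coe_le_coe_iff]
    have := mul_nonneg hx.2.2 (sub_nonneg.2
      (show (∑ j, y.v j + ∑ j, y.w j) / 2 ≤ 1 by linarith [hy.2]))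
    linarith

/-- A Hermitian matrix is determined by its pairing with Hermitian matrices. -/
theorem Matrix.IsHermitian.eq_diagonal_of_re_trace {n : ℕ} {P : Matrix (Fin n) (Fin n) ℂ}
    (hP : P.IsHermitian) (p : Fin n → ℝ)
    (h : ∀ H : Matrix (Fin n) (Fin n) ℂ, H.IsHermitian →
      (P * H).trace.re = ∑ j, p j * (H j j).re) :
    P = Matrix.diagonal fun j => (p j : ℂ) := by
  set D : Matrix (Fin n) (Fin n) ℂ := Matrix.diagonal fun j => (p j : ℂ) with hD
  have hDh : D.IsHermitian := by
    refine Matrix.isHermitian_diagonal_of_self_adjoint _ ?_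
    ext j
    simp
  have hH := hP.sub hDh
  -- The test matrix is `P - D` itself, which yields its squared Frobenius norm.
  have h1 : ((P - D)ᴴ * (P - D)).trace.re = 0 := by
    rw [hH.eq, Matrix.sub_mul, Matrix.trace_sub, Complex.sub_re, h _ hH, re_trace_diagonal_mul,
      sub_self]
  have h2 := Complex.nonneg_iff.1 (Matrix.posSemidef_conjTranspose_mul_self (P - D)).trace_nonneg
  have h3 : ((P - D)ᴴ * (P - D)).trace = 0 := Complex.ext h1 h2.2.symm
  rw [Matrix.trace_conjTranspose_mul_self_eq_zero_iff] at h3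
  exact sub_eq_zero.1 h3

/-- The substance is surjectivity: moving along a Hermitian line in `Y` or `Z` forces the diagonal
blocks of `W` to be `diag(p)` and `diag(q)`. -/
theorem dualIsLagrangeDualOfPrimal {n : ℕ} (A : Matrix (Fin n) (Fin n) ℂ) :
    DualIsLagrangeDualOfPrimal A := by
  refine ⟨⟨fun y hy => ⟨y.posSemidef_toMultiplier_iff.2 hy.1, ?_⟩, ?_, ?_⟩,
    fun y hy => primalLagrangeFun_toMultiplier A hy⟩
  · rw [primalLagrangeFun_toMultiplier A hy]
    exact EReal.bot_lt_coe _
  · rintro ⟨X, v, w⟩ - ⟨X', v', w'⟩ - h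
    simp only [DualPoint.toMultiplier, Prod.mk.injEq] at h
    obtain ⟨h1, h2, h3⟩ := h
    have h1' := smul_right_injective _ (by norm_num : (1 / 2 : ℂ) ≠ 0) h1
    rw [Matrix.fromBlocks_inj] at h1'
    have hv : v = v' := by
      ext j
      have := congrFun h2 j
      linarith
    have hw : w = w' := by
      ext j
      have := congrFun h3 j
      linarith
    rw [neg_injective h1'.2.1, hv, hw]
  · rintro ⟨W, p, q⟩ ⟨hW, hg⟩
    obtain ⟨r, -, hr⟩ := EReal.lt_iff_exists_real_btwn.1 hg
    have hr' : ∀ x ∈ primalDomain n, r ≤ primalLagrangian A x (W, p, q) := by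
      intro x hx
      have := hr.le.trans (iInf₂_le x hx)
      exact_mod_cast this
    obtain ⟨P, X, X', Q, rfl⟩ : ∃ P X X' Q, W = Matrix.fromBlocks P X X' Q :=
      ⟨_, _, _, _, (Matrix.fromBlocks_toBlocks W).symm⟩
    dsimp only at hW
    obtain ⟨hPh, hXX, -, hQh⟩ := Matrix.isHermitian_fromBlocks_iff.1 hW.1
    subst hXX
    have hL : ∀ x : PrimalPoint n, primalLagrangian A x (Matrix.fromBlocks P X Xᴴ Q, p, q)
        = -(X * Aᴴ).trace.re - (Xᴴ * A).trace.re + x.c * (1 - (∑ j, p j + ∑ j, q j))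
          + (∑ j, p j * (x.Y j j).re - (P * x.Y).trace.re)
          + (∑ j, q j * (x.Z j j).re - (Q * x.Z).trace.re) := by
      intro x
      simp only [primalLagrangian, PrimalPoint.block, Matrix.trace_fromBlocks_mul_fromBlocks,
        mul_sub, Finset.sum_sub_distrib, ← Finset.sum_mul, Complex.add_re]
      ring
    have hsm : ∀ (t : ℝ) (H : Matrix (Fin n) (Fin n) ℂ), H.IsHermitian →
        ((t : ℂ) • H).IsHermitian := by
      intro t H hH
      rw [Matrix.IsHermitian, Matrix.conjTranspose_smul, hH.eq]
      simp
    have hP : P = Matrix.diagonal fun j => (p j : ℂ) := by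
      refine hPh.eq_diagonal_of_re_trace p fun H hH => (sub_eq_zero.1 ?_).symm
      refine eq_zero_of_forall_le_add_mul (r := r) (a := -(X * Aᴴ).trace.re - (Xᴴ * A).trace.re)
        fun t => ?_
      have := hr' ⟨0, (t : ℂ) • H, 0⟩ ⟨hsm t H hH, Matrix.isHermitian_zero, le_rfl⟩
      rw [hL] at this
      simpa [mul_sub, Finset.mul_sum, mul_left_comm] using this
    have hQ : Q = Matrix.diagonal fun j => (q j : ℂ) := by
      refine hQh.eq_diagonal_of_re_trace q fun H hH => (sub_eq_zero.1 ?_).symm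
      refine eq_zero_of_forall_le_add_mul (r := r) (a := -(X * Aᴴ).trace.re - (Xᴴ * A).trace.re)
        fun t => ?_
      have := hr' ⟨0, 0, (t : ℂ) • H⟩ ⟨Matrix.isHermitian_zero, hsm t H hH, le_rfl⟩
      rw [hL] at this
      simpa [mul_sub, Finset.mul_sum, mul_left_comm] using this
    -- Only the half-line `c ≥ 0` is available, so the slope is nonnegative rather than zero.
    have hc : 0 ≤ 1 - (∑ j, p j + ∑ j, q j) := by
      refine nonneg_of_forall_le_add_mul (r := r)
        (a := -(X * Aᴴ).trace.re - (Xᴴ * A).trace.re) fun t ht => ?_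
      have := hr' ⟨t, 0, 0⟩ ⟨Matrix.isHermitian_zero, Matrix.isHermitian_zero, ht⟩
      rw [hL] at this
      simpa using this
    have hm : DualPoint.toMultiplier ⟨(-2 : ℂ) • X, fun j => 2 * p j, fun j => 2 * q j⟩
        = (Matrix.fromBlocks P X Xᴴ Q, p, q) := by
      have hd : ∀ p : Fin n → ℝ, (2⁻¹ : ℂ) • Matrix.diagonal (fun j => 2 * (p j : ℂ))
          = Matrix.diagonal fun j => (p j : ℂ) := by
        intro p
        rw [← Matrix.diagonal_smul]
        congr 1
        ext j
        simp
      simp [DualPoint.toMultiplier, Matrix.fromBlocks_smul, hP, hQ, hd, smul_smul,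
        Matrix.conjTranspose_smul]
    refine ⟨_, ⟨?_, ?_⟩, hm⟩
    · rw [← DualPoint.posSemidef_toMultiplier_iff, hm]
      exact hW
    · simp only [← Finset.mul_sum]
      linarith

/-! ### The Lagrangian of the maximization problem. -/

theorem dualLagrangian_fromBlocks {n : ℕ} (A P X Q : Matrix (Fin n) (Fin n) ℂ) (κ : ℝ)
    (y : DualPoint n) : dualLagrangian A y (Matrix.fromBlocks P X Xᴴ Q, κ)
      = ((A + (2 : ℂ) • X) * y.Xᴴ).trace.re + ∑ j, y.v j * ((P j j).re - κ)
        + ∑ j, y.w j * ((Q j j).re - κ) + 2 * κ := by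
  have h1 : (Xᴴ * y.X).trace.re = (X * y.Xᴴ).trace.re := by
    rw [Matrix.trace_mul_comm, re_trace_mul_conjTranspose_comm]
  have h2 := re_trace_mul_diagonal y.v P
  have h3 := re_trace_mul_diagonal y.w Q
  simp only [dualLagrangian, DualPoint.block, Matrix.trace_fromBlocks_mul_fromBlocks,
    dualObjective, Matrix.add_mul, Matrix.trace_add, Complex.add_re, Matrix.smul_mul,
    Matrix.trace_smul, mul_sub, Finset.sum_sub_distrib, ← Finset.sum_mul, h1, h2, h3]
  simp
  ring

/-- All slopes in `X, v, w` vanish here, leaving the constant `2κ = c`. -/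
theorem dualLagrangian_toMultiplier {n : ℕ} {A : Matrix (Fin n) (Fin n) ℂ} {x : PrimalPoint n}
    (hx : x ∈ primalFeasible A) (y : DualPoint n) :
    dualLagrangian A y (x.toMultiplier A) = x.c := by
  have : x.toMultiplier A = (Matrix.fromBlocks ((1 / 2 : ℂ) • x.Y) ((-1 / 2 : ℂ) • A)
      ((-1 / 2 : ℂ) • A)ᴴ ((1 / 2 : ℂ) • x.Z), x.c / 2) := by
    simp [PrimalPoint.toMultiplier, Matrix.fromBlocks_smul, Matrix.conjTranspose_smul,
      neg_div]
  rw [this, dualLagrangian_fromBlocks, smul_smul]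
  have h : ∀ j, x.Y j j = x.c ∧ x.Z j j = x.c := hx.2.2.2
  simp [h, div_eq_inv_mul]

theorem dualLagrangeFun_toMultiplier {n : ℕ} {A : Matrix (Fin n) (Fin n) ℂ} {x : PrimalPoint n}
    (hx : x ∈ primalFeasible A) : dualLagrangeFun A (x.toMultiplier A) = (x.c : EReal) := by
  have : Nonempty (DualPoint n) := ⟨⟨0, 0, 0⟩⟩
  simp only [dualLagrangeFun, dualLagrangian_toMultiplier hx, ciSup_const]

theorem primalIsLagrangeDualOfDual {n : ℕ} (hn : 0 < n) (A : Matrix (Fin n) (Fin n) ℂ) :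
    PrimalIsLagrangeDualOfDual A := by
  refine ⟨⟨fun x hx => ⟨(x.posSemidef_toMultiplier_iff A).2 hx.2.2.1, ?_, ?_⟩, ?_, ?_⟩,
    fun x hx => dualLagrangeFun_toMultiplier hx⟩
  · exact div_nonneg (primalFeasible.c_nonneg hn hx) (by norm_num)
  · rw [dualLagrangeFun_toMultiplier hx]
    exact EReal.coe_lt_top _
  · rintro ⟨c, Y, Z⟩ - ⟨c', Y', Z'⟩ - h
    simp only [PrimalPoint.toMultiplier, Prod.mk.injEq] at h
    obtain ⟨h1, h2⟩ := h
    have h1' := smul_right_injective _ (by norm_num : (1 / 2 : ℂ) ≠ 0) h1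
    rw [Matrix.fromBlocks_inj] at h1'
    rw [h1'.1, h1'.2.2.2, show c = c' by linarith]
  · rintro ⟨N, κ⟩ ⟨hN, hκ, hh⟩
    obtain ⟨r, hr, -⟩ := EReal.lt_iff_exists_real_btwn.1 hh
    have hr' : ∀ y : DualPoint n, dualLagrangian A y (N, κ) ≤ r := by
      intro y
      have := (le_iSup (fun y => (dualLagrangian A y (N, κ) : EReal)) y).trans hr.le
      exact_mod_cast this
    obtain ⟨P, X, X', Q, rfl⟩ : ∃ P X X' Q, N = Matrix.fromBlocks P X X' Q :=
      ⟨_, _, _, _, (Matrix.fromBlocks_toBlocks N).symm⟩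
    dsimp only at hN
    obtain ⟨hPh, hXX, -, hQh⟩ := Matrix.isHermitian_fromBlocks_iff.1 hN.1
    subst hXX
    simp only [dualLagrangian_fromBlocks] at hr'
    have hX : A + (2 : ℂ) • X = 0 := by
      rw [← Matrix.trace_mul_conjTranspose_self_eq_zero_iff]
      set B := A + (2 : ℂ) • X
      have h2 := Complex.nonneg_iff.1 (Matrix.posSemidef_self_mul_conjTranspose B).trace_nonneg
      refine Complex.ext (neg_eq_zero.1 ?_) h2.2.symm
      refine eq_zero_of_forall_le_add_mul (r := -r) (a := -(2 * κ)) fun t => ?_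
      -- In the direction `B` the slope is the squared Frobenius norm of `B`.
      have := hr' ⟨(t : ℂ) • B, 0, 0⟩
      simp [Matrix.conjTranspose_smul] at this
      linarith
    have hP : ∀ j, (P j j).re = κ := by
      intro j
      refine sub_eq_zero.1 (neg_eq_zero.1 ?_)
      refine eq_zero_of_forall_le_add_mul (r := -r) (a := -(2 * κ)) fun t => ?_
      have := hr' ⟨0, Pi.single j t, 0⟩
      simp [Pi.single_apply] at this
      linarith
    have hQ : ∀ j, (Q j j).re = κ := by
      intro j
      refine sub_eq_zero.1 (neg_eq_zero.1 ?_)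
      refine eq_zero_of_forall_le_add_mul (r := -r) (a := -(2 * κ)) fun t => ?_
      have := hr' ⟨0, 0, Pi.single j t⟩
      simp [Pi.single_apply] at this
      linarith
    have hA : A = (-2 : ℂ) • X := by
      rw [neg_smul]
      exact eq_neg_of_add_eq_zero_left hX
    have hm : PrimalPoint.toMultiplier A ⟨2 * κ, (2 : ℂ) • P, (2 : ℂ) • Q⟩
        = (Matrix.fromBlocks P X Xᴴ Q, κ) := by
      simp [PrimalPoint.toMultiplier, Matrix.fromBlocks_smul, hA, smul_smul,
        Matrix.conjTranspose_smul]
    have h2 : ∀ {H : Matrix (Fin n) (Fin n) ℂ}, H.IsHermitian → ((2 : ℂ) • H).IsHermitian := by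
      intro H hH
      rw [Matrix.IsHermitian, Matrix.conjTranspose_smul, hH.eq]
      simp
    refine ⟨_, ⟨h2 hPh, h2 hQh, ?_, fun j => ?_⟩, hm⟩
    · rw [← PrimalPoint.posSemidef_toMultiplier_iff, hm]
      exact hN
    -- The Lagrangian sees only real parts of the diagonal; Hermitian symmetry makes the entries
    -- real.
    · have e1 := hPh.coe_re_apply_self j
      have e2 := hQh.coe_re_apply_self j
      simp only [RCLike.re_eq_complex_re, hP, hQ] at e1 e2
      simp only [Matrix.smul_apply, smul_eq_mul, ← e1, ← e2]
      simp

/-! ### Completable partial matrices and separation. -/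

section PartialMatrixCone

/-- The diagonal and the upper right block of a `2 × 2` block matrix. -/
noncomputable def diagAndCorner (n : ℕ) : Matrix (Fin n ⊕ Fin n) (Fin n ⊕ Fin n) ℂ →ₗ[ℝ]
    (Fin n ⊕ Fin n → ℝ) × (Fin n → Fin n → ℂ) where
  toFun M := (fun k => (M k k).re, fun i j => M (Sum.inl i) (Sum.inr j))
  map_add' M N := by
    ext <;> simp
  map_smul' t M := by
    ext <;> simp

theorem continuous_diagAndCorner (n : ℕ) : Continuous (diagAndCorner n) := by
  refine Continuous.prodMk (continuous_pi fun k => ?_)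
    (continuous_pi fun i => continuous_pi fun j => ?_)
  · exact Complex.continuous_re.comp (continuous_id.matrix_elem k k)
  · exact continuous_id.matrix_elem _ _

/-- This is nonnegativity of the `2 × 2` principal minor. -/
theorem Matrix.PosSemidef.norm_sq_apply_le {m : Type*} [Fintype m] [DecidableEq m]
    {M : Matrix m m ℂ} (hM : M.PosSemidef) (i j : m) :
    ‖M i j‖ ^ 2 ≤ (M i i).re * (M j j).re := by
  have h := (hM.submatrix ![i, j]).det_nonneg
  rw [Matrix.det_fin_two] at h
  have hji : M j i = star (M i j) := (hM.1.apply j i).symm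
  have hi := hM.1.coe_re_apply_self i
  have hj := hM.1.coe_re_apply_self j
  simp only [RCLike.re_eq_complex_re] at hi hj
  simp only [Matrix.submatrix_apply, Matrix.cons_val_zero, Matrix.cons_val_one, hji] at h
  rw [← hi, ← hj, ← starRingEnd_apply, Complex.mul_conj, Complex.normSq_eq_norm_sq] at h
  have h' : (0 : ℂ) ≤ (((M i i).re * (M j j).re - ‖M i j‖ ^ 2 : ℝ) : ℂ) := by
    push_cast
    simpa using h
  have := Complex.zero_le_real.1 h'
  linarith

theorem isClosed_posSemidef (m : Type*) [Fintype m] [DecidableEq m] :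
    IsClosed {M : Matrix m m ℂ | M.PosSemidef} := by
  have : {M : Matrix m m ℂ | M.PosSemidef}
      = {M | Mᴴ = M} ∩ ⋂ x : m → ℂ, {M | 0 ≤ star x ⬝ᵥ M *ᵥ x} := by
    ext M
    simp only [Set.mem_ofPred_eq, Set.mem_inter_iff, Set.mem_iInter]
    exact Matrix.posSemidef_iff_dotProduct_mulVec
  rw [this]
  refine (isClosed_eq (by fun_prop) continuous_id).inter (isClosed_iInter fun x => ?_)
  exact isClosed_le continuous_const (by fun_prop)

theorem isCompact_posSemidef_diag_le (m : Type*) [Fintype m] [DecidableEq m] (R : ℝ) :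
    IsCompact {M : Matrix m m ℂ | M.PosSemidef ∧ ∀ k, (M k k).re ≤ R} := by
  have hc : IsCompact (Set.univ.pi fun _ : m => Set.univ.pi fun _ : m =>
      Metric.closedBall (0 : ℂ) R) :=
    isCompact_univ_pi fun _ => isCompact_univ_pi fun _ => isCompact_closedBall _ _
  have hd : IsClosed {M : Matrix m m ℂ | ∀ k, (M k k).re ≤ R} := by
    rw [Set.ofPred_forall]
    refine isClosed_iInter fun k => isClosed_le ?_ continuous_const
    exact Complex.continuous_re.comp (continuous_id.matrix_elem k k)
  refine IsCompact.of_isClosed_subset hc ((isClosed_posSemidef m).inter hd) ?_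
  rintro M ⟨hM, hR⟩ i - j -
  have h0 : ∀ k, 0 ≤ (M k k).re := fun k => (Complex.nonneg_iff.1 hM.diag_nonneg).1
  rw [mem_closedBall_zero_iff]
  refine abs_le_of_sq_le_sq' ?_ ((h0 i).trans (hR i)) |>.2
  calc ‖M i j‖ ^ 2 ≤ _ := hM.norm_sq_apply_le i j
    _ ≤ R * R := mul_le_mul (hR i) (hR j) (h0 j) ((h0 i).trans (hR i))
    _ = R ^ 2 := (sq R).symm

/-- A linear image of a closed cone may fail to be closed. Here the retained diagonal bounds every
entry of a preimage, so preimages of a convergent sequence subconverge. -/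
theorem isClosed_diagAndCorner_image (n : ℕ) :
    IsClosed (diagAndCorner n '' {M | M.PosSemidef}) := by
  refine IsSeqClosed.isClosed fun u x hu hx => ?_
  choose M hM hMu using hu
  obtain ⟨R, hR⟩ := (Metric.isBounded_range_of_tendsto u hx).exists_norm_le
  have hmem : ∀ k, M k ∈ {M : Matrix (Fin n ⊕ Fin n) (Fin n ⊕ Fin n) ℂ |
      M.PosSemidef ∧ ∀ j, (M j j).re ≤ R} := by
    refine fun k => ⟨hM k, fun j => ?_⟩
    calc (M k j j).re = (u k).1 j := by rw [← hMu k]; rfl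
      _ ≤ ‖(u k).1 j‖ := Real.le_norm_self _
      _ ≤ ‖(u k).1‖ := norm_le_pi_norm _ _
      _ ≤ ‖u k‖ := norm_fst_le _
      _ ≤ R := hR _ (Set.mem_range_self k)
  have : FirstCountableTopology (Matrix (Fin n ⊕ Fin n) (Fin n ⊕ Fin n) ℂ) :=
    inferInstanceAs (FirstCountableTopology (Fin n ⊕ Fin n → Fin n ⊕ Fin n → ℂ))
  obtain ⟨L, hL, φ, hφ, hlim⟩ := (isCompact_posSemidef_diag_le _ R).tendsto_subseq hmem
  refine ⟨L, hL.1, ?_⟩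
  have h1 := ((continuous_diagAndCorner n).tendsto L).comp hlim
  have h2 := hx.comp hφ.tendsto_atTop
  refine tendsto_nhds_unique (h1.congr fun k => ?_) h2
  simp [hMu]

theorem convex_posSemidef (m : Type*) [Fintype m] :
    Convex ℝ {M : Matrix m m ℂ | M.PosSemidef} := by
  intro M hM N hN a b ha hb _
  exact (Matrix.PosSemidef.smul hM ha).add (Matrix.PosSemidef.smul hN hb)

/-- A real linear functional on the diagonal and the corner is a pairing with some `(v, w, X)`. -/
theorem exists_dualPoint_of_linearMap {n : ℕ}
    (f : (Fin n ⊕ Fin n → ℝ) × (Fin n → Fin n → ℂ) →ₗ[ℝ] ℝ) :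
    ∃ y : DualPoint n, ∀ d B, f (d, B) = ∑ j, y.v j * d (Sum.inl j) + ∑ j, y.w j * d (Sum.inr j)
      - 2 * (∑ i, ∑ j, B i j * star (y.X i j)).re := by
  -- The real and imaginary parts of `X` are read off from `f` at `E_ij` and `i E_ij`; `-1/2`
  -- compensates the factor `-2` in the pairing.
  refine ⟨⟨Matrix.of fun i j => ((-f (0, Pi.single i (Pi.single j 1)) / 2 : ℝ) : ℂ)
      + ((-f (0, Pi.single i (Pi.single j Complex.I)) / 2 : ℝ) : ℂ) * Complex.I,
    fun j => f (Pi.single (Sum.inl j) 1, 0), fun j => f (Pi.single (Sum.inr j) 1, 0)⟩,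
    fun d B => ?_⟩
  have hd : (d, (0 : Fin n → Fin n → ℂ)) = ∑ k, d k • (Pi.single k (1 : ℝ), 0) := by
    refine Prod.ext ?_ ?_
    · funext k
      simp [-Fintype.sum_sum_type, Prod.fst_sum, Finset.sum_apply, Pi.single_apply]
    · simp [Prod.snd_sum]
  have hB : ((0 : Fin n ⊕ Fin n → ℝ), B) = ∑ i, ∑ j,
      ((B i j).re • ((0 : Fin n ⊕ Fin n → ℝ), Pi.single i (Pi.single j (1 : ℂ)))
        + (B i j).im • ((0 : Fin n ⊕ Fin n → ℝ), Pi.single i (Pi.single j Complex.I))) := by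
    refine Prod.ext ?_ ?_
    · simp [Prod.fst_sum]
    · funext i j
      simp only [Prod.snd_sum, Finset.sum_apply, Prod.snd_add, Prod.smul_snd, Pi.add_apply,
        Pi.smul_apply]
      rw [Finset.sum_eq_single i (fun i' _ hi => by simp [Pi.single_eq_of_ne hi.symm]) (by simp),
        Finset.sum_eq_single j (fun j' _ hj => by simp [Pi.single_eq_of_ne hj.symm]) (by simp)]
      simp
  have h : (d, B) = (d, 0) + (0, B) := by simp
  rw [h, map_add, hd, hB]
  simp only [map_sum, map_add, map_smul, Fintype.sum_sum_type, smul_eq_mul]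
  have : ∀ i j, (B i j * star ((Matrix.of fun i j =>
      ((-f (0, Pi.single i (Pi.single j 1)) / 2 : ℝ) : ℂ)
      + ((-f (0, Pi.single i (Pi.single j Complex.I)) / 2 : ℝ) : ℂ) * Complex.I) i j)).re
      = -((B i j).re * f (0, Pi.single i (Pi.single j 1))
        + (B i j).im * f (0, Pi.single i (Pi.single j Complex.I))) / 2 := by
    intro i j
    simp
    ring
  simp only [Complex.re_sum, this, ← Finset.sum_div, Finset.sum_neg_distrib]
  simp only [mul_comm (f _)]
  ring

/-- Matches the pairing of `exists_dualPoint_of_linearMap` on rank-one data, except for the sign of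
the corner term. -/
theorem DualPoint.star_dotProduct_block_mulVec {n : ℕ} (y : DualPoint n) (ξ : Fin n ⊕ Fin n → ℂ) :
    (star ξ ⬝ᵥ y.block *ᵥ ξ).re = ∑ j, y.v j * ‖ξ (Sum.inl j)‖ ^ 2
      + ∑ j, y.w j * ‖ξ (Sum.inr j)‖ ^ 2
      + 2 * (∑ i, ∑ j, ξ (Sum.inl i) * star (ξ (Sum.inr j)) * star (y.X i j)).re := by
  set S := ∑ i, ∑ j, ξ (Sum.inl i) * star (ξ (Sum.inr j)) * star (y.X i j) with hS
  have h : star ξ ⬝ᵥ y.block *ᵥ ξ = ((∑ j, y.v j * ‖ξ (Sum.inl j)‖ ^ 2 : ℝ) : ℂ)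
      + ((∑ j, y.w j * ‖ξ (Sum.inr j)‖ ^ 2 : ℝ) : ℂ) + (star S + S) := by
    have h1 : ∀ j, star (ξ j) * ξ j = ((‖ξ j‖ ^ 2 : ℝ) : ℂ) := fun j => by
      rw [mul_comm, ← starRingEnd_apply, Complex.mul_conj, Complex.normSq_eq_norm_sq]
    have h2 : star S = ∑ i, star (ξ (Sum.inl i)) * ∑ j, y.X i j * ξ (Sum.inr j) := by
      simp only [hS, star_sum, star_mul', star_star, Finset.mul_sum]
      exact Finset.sum_congr rfl fun i _ => Finset.sum_congr rfl fun j _ => by ring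
    have h3 : S = ∑ j, star (ξ (Sum.inr j)) * ∑ i, star (y.X i j) * ξ (Sum.inl i) := by
      rw [hS, Finset.sum_comm]
      simp only [Finset.mul_sum]
      exact Finset.sum_congr rfl fun i _ => Finset.sum_congr rfl fun j _ => by ring
    have h4 : ∀ (p : Fin n → ℝ) (k : Fin n → Fin n ⊕ Fin n),
        ((∑ j, p j * ‖ξ (k j)‖ ^ 2 : ℝ) : ℂ) = ∑ j, star (ξ (k j)) * (p j * ξ (k j)) := by
      intro p k
      rw [Complex.ofReal_sum]
      refine Finset.sum_congr rfl fun j _ => ?_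
      rw [Complex.ofReal_mul, ← h1]
      ring
    rw [h4, h4, h2]
    conv_rhs => rw [h3]
    simp only [dotProduct, Matrix.mulVec, Fintype.sum_sum_type, DualPoint.block, Pi.star_apply,
      Matrix.fromBlocks_apply₁₁, Matrix.fromBlocks_apply₁₂, Matrix.fromBlocks_apply₂₁,
      Matrix.fromBlocks_apply₂₂, Matrix.conjTranspose_apply, Matrix.diagonal_apply, ite_mul,
      zero_mul, Finset.sum_ite_eq, Finset.mem_univ, if_true, mul_add, Finset.sum_add_distrib]
    ring
  rw [h]
  simp only [Complex.add_re, Complex.ofReal_re, Complex.star_def, Complex.conj_re]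
  ring

theorem exists_primalFeasible_schurNorm {n : ℕ} (hn : 0 < n) (A : Matrix (Fin n) (Fin n) ℂ) :
    ∃ x ∈ primalFeasible A, x.c = schurNorm A := by
  set s := schurNorm A
  by_cases hmem : ((fun _ => s, A) : (Fin n ⊕ Fin n → ℝ) × (Fin n → Fin n → ℂ))
      ∈ diagAndCorner n '' {M | M.PosSemidef}
  · obtain ⟨M, hM, hMA⟩ := hmem
    have hM' : M.PosSemidef := hM
    have hd : ∀ k, M k k = s := fun k => by
      rw [← hM'.1.coe_re_apply_self k]
      exact congrArg Complex.ofReal (congrFun (congrArg Prod.fst hMA) k)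
    have hA : M.toBlocks₁₂ = A := congrArg Prod.snd hMA
    have hM2 : (Matrix.fromBlocks M.toBlocks₁₁ M.toBlocks₁₂ M.toBlocks₂₁ M.toBlocks₂₂).PosSemidef :=
      by rwa [Matrix.fromBlocks_toBlocks]
    obtain ⟨h1, h2, -, h4⟩ := Matrix.isHermitian_fromBlocks_iff.1 hM2.1
    refine ⟨⟨s, M.toBlocks₁₁, M.toBlocks₂₂⟩, ⟨h1, h4, ?_, fun j => ⟨hd _, hd _⟩⟩, rfl⟩
    rwa [← h2, hA] at hM2
  · exfalso
    obtain ⟨f, u, hfu, hu⟩ := geometric_hahn_banach_point_closed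
      ((convex_posSemidef _).linear_image (diagAndCorner n)) (isClosed_diagAndCorner_image n) hmem
    obtain ⟨y, hy⟩ := exists_dualPoint_of_linearMap f.toLinearMap
    have hu0 : u < 0 := by
      have := hu 0 ⟨0, Matrix.PosSemidef.zero, map_zero _⟩
      simpa using this
    have hnn : ∀ M : Matrix (Fin n ⊕ Fin n) (Fin n ⊕ Fin n) ℂ, M.PosSemidef →
        0 ≤ f (diagAndCorner n M) := by
      intro M hM
      -- A functional bounded below on a cone is nonnegative there.
      refine nonneg_of_forall_le_add_mul (r := u) (a := 0) fun t ht => ?_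
      have := hu _ ⟨t • M, Matrix.PosSemidef.smul hM ht, rfl⟩
      rw [map_smul, map_smul] at this
      simpa using this.le
    have hblock : y.block.PosSemidef := by
      have hH : y.block.IsHermitian := by
        refine Matrix.isHermitian_fromBlocks_iff.2 ⟨?_, rfl, y.X.conjTranspose_conjTranspose, ?_⟩ <;>
        · refine Matrix.isHermitian_diagonal_of_self_adjoint _ ?_
          ext j
          simp
      refine Matrix.PosSemidef.of_dotProduct_mulVec_nonneg hH fun ξ => ?_
      refine Complex.nonneg_iff.2 ⟨?_, (hH.im_star_dotProduct_mulVec_self ξ).symm⟩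
      rw [y.star_dotProduct_block_mulVec]
      -- Negating the lower half of `ξ` absorbs the sign of the corner term.
      set ζ : Fin n ⊕ Fin n → ℂ := Sum.elim (fun i => ξ (Sum.inl i)) (fun i => -ξ (Sum.inr i))
      have h := hnn _ (Matrix.posSemidef_vecMulVec_self_star ζ)
      have e : f (diagAndCorner n (Matrix.vecMulVec ζ (star ζ))) = _ := hy _ _
      rw [e] at h
      have h1 : ∀ k, (Matrix.vecMulVec ζ (star ζ) k k).re = ‖ξ k‖ ^ 2 := by
        intro k
        rw [Matrix.vecMulVec_apply, Pi.star_apply, ← starRingEnd_apply, Complex.mul_conj,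
          Complex.ofReal_re, Complex.normSq_eq_norm_sq]
        rcases k with k | k <;> simp [ζ]
      simp only [h1] at h
      simpa only [Matrix.vecMulVec_apply, ζ, Pi.star_apply, Sum.elim_inl, Sum.elim_inr,
        star_neg, mul_neg, neg_mul, Finset.sum_neg_distrib, Complex.neg_re, sub_neg_eq_add] using h
    have h := dualObjective_le_schurNorm_mul hn A y hblock
    have e : f ((fun _ => s, A) : (Fin n ⊕ Fin n → ℝ) × (Fin n → Fin n → ℂ)) = _ := hy _ _
    rw [e, ← dualObjective_eq_sum, ← Finset.sum_mul, ← Finset.sum_mul] at hfu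
    -- The separated value `s (∑ v + ∑ w) - 2 Re Tr(A X*)` is below `u < 0`, but `h` makes it
    -- nonnegative.
    nlinarith

end PartialMatrixCone

theorem theorem5 {n : ℕ} (hn : 0 < n) (A : Matrix (Fin n) (Fin n) ℂ) :
    IsLeast (PrimalPoint.c '' primalFeasible A) (schurNorm A) ∧
      IsGreatest (dualObjective A '' dualFeasible n) (schurNorm A) ∧
      DualIsLagrangeDualOfPrimal A ∧
      PrimalIsLagrangeDualOfDual A := by
  obtain ⟨x, hx, hxs⟩ := exists_primalFeasible_schurNorm hn A
  obtain ⟨y, hy, hys⟩ := exists_dualFeasible_objective_eq hn A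
  refine ⟨⟨⟨x, hx, hxs⟩, ?_⟩, ⟨⟨y, hy, hys⟩, ?_⟩, dualIsLagrangeDualOfPrimal A,
    primalIsLagrangeDualOfDual hn A⟩
  · rintro _ ⟨x', hx', rfl⟩
    exact hys ▸ weak_duality hn hx' hy
  · rintro _ ⟨y', hy', rfl⟩
    exact hxs ▸ weak_duality hn hx hy'
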